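/- Let $\mathbb{H}=\{z\in\mathbb{C}:\operatorname{Im} z>0\}$ with the pseudo-hyperbolic distance $d(z,w)=\left|\frac{w-z}{w-\overline{z}}\right|$. Let $\phi:\mathbb{H}\to\mathbb{H}$ be analytic and of parabolic type with Denjoy–Wolff point $\infty$, i.e. $\phi(z)\to\infty$ and $\phi(z)/z\to 1$ as $z\to\infty$ in each sector $\{|\operatorname{Arg} z-\pi/2|<\theta\}$, $0<\theta<\pi/2$. Let $w_n=x_n+iy_n$ and $\tilde w_n=\tilde x_n+i\tilde y_n$ $(n\ge 0)$ be two sequences in $\mathbb{H}$ with $\phi(w_{n+1})=w_n$ and $\phi(\tilde w_{n+1})=\tilde w_n$ for all $n$, both tending to $\infty$ with arguments tending to $0$, with steps bounded away from $1$, \[ d(w_n,w_{n+1})\uparrow a<1,\qquad d(\tilde w_n,\tilde w_{n+1})\uparrow\tilde a<1, \] and of non-zero height: $y_n\downarrow\ell_\infty>0$, $\tilde y_n\downarrow\tilde\ell_\infty>0$. Put $b_0=\frac{2a}{\sqrt{1-a^2}}$, $\tilde b_0=\frac{2\tilde a}{\sqrt{1-\tilde a^2}}$; these are positive. Let $\tau_n(z)=x_n+y_nz$,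 $\tilde\tau_n(z)=\tilde x_n+\tilde y_nz$, and let $\phi_n$ denote the $n$-th iterate of $\phi$. Then the sequences $\phi_n\circ\tau_n$ and $\phi_n\circ\tilde\tau_n$ converge uniformly on compact subsets of $\mathbb{H}$ to analytic self-maps $\psi$ and $\tilde\psi$ of $\mathbb{H}$ satisfying $\psi(z-b_0)=\phi(\psi(z))$ and $\tilde\psi(z-\tilde b_0)=\phi(\tilde\psi(z))$ for $z\in\mathbb{H}$, and there is $b_1\in\mathbb{R}$ such that \[ \tilde\psi\Big(\frac{\tilde b_0}{b_0}z+b_1\Big)=\psi(z)\qquad(z\in\mathbb{H}). \] Moreover, for this $b_1$ and $z_1=\frac{b_0}{\tilde b_0}(i-b_1)$, one has $\tilde w_n=\psi(z_1+nb_0)$ for all $n\ge 0$. Finally, \[ \lim_{n\to\infty}(x_{n+1}-x_n)=\ell_\infty b_0=\tilde\ell_\infty\tilde b_0=\lim_{n\to\infty}(\tilde x_{n+1}-\tilde x_n). \] -/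

import Mathlib

open Filter Topology

/-- The open upper half-plane, as a subset of the complex plane. -/
def upperHalf : Set ℂ := {z : ℂ | 0 < z.im}

/-- The pseudo-hyperbolic distance `|w - z| / |w - conj z|` of the upper half-plane. -/
noncomputable def pseudoHypDist (z w : ℂ) : ℝ :=
  ‖(w - z) / (w - (starRingEnd ℂ) z)‖

/-- The sector `{|Arg z - π/2| < θ}`; for `0 < θ < π/2` these are the non-tangential approach
regions at infinity in the upper half-plane. -/
def sectorAtInfty (θ : ℝ) : Set ℂ := {z : ℂ | |z.arg - Real.pi / 2| < θ}

/-- `f` tends to `l` as `z` tends to infinity non-tangentially in the upper half-plane. -/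
def TendstoNontangentially (f : ℂ → ℂ) (l : Filter ℂ) : Prop :=
  ∀ θ : ℝ, 0 < θ → θ < Real.pi / 2 →
    Tendsto f (Bornology.cobounded ℂ ⊓ 𝓟 (sectorAtInfty θ)) l

/-- An analytic self-map of the upper half-plane of parabolic type whose Denjoy-Wolff point is
infinity: `φ z → ∞` and `φ z / z → 1` as `z → ∞` non-tangentially. Only the values of `φ` on
the upper half-plane matter. -/
structure IsParabolicSelfMap (φ : ℂ → ℂ) : Prop where
  differentiableOn : DifferentiableOn ℂ φ upperHalf
  mapsTo : Set.MapsTo φ upperHalf upperHalf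
  tendsto_infty : TendstoNontangentially φ (Bornology.cobounded ℂ)
  tendsto_div : TendstoNontangentially (fun z => φ z / z) (𝓝 1)

/-- A backward-iteration sequence with bounded (pseudo-hyperbolic) steps for `φ`. -/
structure IsBISBS (φ : ℂ → ℂ) (w : ℕ → ℂ) : Prop where
  mem : ∀ n, w n ∈ upperHalf
  map_succ : ∀ n, φ (w (n + 1)) = w n
  bounded_steps : ∃ c : ℝ, c < 1 ∧ ∀ n, pseudoHypDist (w n) (w (n + 1)) ≤ c

/-- A backward-iteration sequence with bounded steps which tends to infinity with argument tending
to `0`, whose steps tend to `a` and whose imaginary parts tend to `ℓ > 0`. -/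
structure IsNonzeroHeightBISBS (φ : ℂ → ℂ) (w : ℕ → ℂ) (a ℓ : ℝ) : Prop extends IsBISBS φ w where
  tendsto_infty : Tendsto w atTop (Bornology.cobounded ℂ)
  tendsto_arg : Tendsto (fun n => (w n).arg) atTop (𝓝 0)
  tendsto_step : Tendsto (fun n => pseudoHypDist (w n) (w (n + 1))) atTop (𝓝 a)
  tendsto_im : Tendsto (fun n => (w n).im) atTop (𝓝 ℓ)
  height_pos : 0 < ℓ

/-- The translation length `b₀ = 2a / √(1 - a²)` attached to the limit step `a`. -/
noncomputable def translationLength (a : ℝ) : ℝ := 2 * a / Real.sqrt (1 - a ^ 2)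

/-- The automorphism `τ(z) = x + y z` of the upper half-plane, where `p = x + i y`. -/
noncomputable def affineAt (p z : ℂ) : ℂ := (p.re : ℂ) + (p.im : ℂ) * z

/-- `ψ` is the conjugation attached to the backward-iteration sequence `w` of `φ`: the
normalized iterates `φ ∘ ⋯ ∘ φ ∘ τₙ` (`n` copies of `φ`, `τₙ(z) = xₙ + yₙ z`) converge to `ψ`
uniformly on the compact subsets of the upper half-plane, `ψ` is an analytic self-map of the
upper half-plane, and `ψ (z - b) = φ (ψ z)`. -/
structure IsConjugation (φ : ℂ → ℂ) (w : ℕ → ℂ) (b : ℝ) (ψ : ℂ → ℂ) : Prop where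
  differentiableOn : DifferentiableOn ℂ ψ upperHalf
  mapsTo : Set.MapsTo ψ upperHalf upperHalf
  tendsto_compact : ∀ K : Set ℂ, K ⊆ upperHalf → IsCompact K →
    TendstoUniformlyOn (fun (n : ℕ) (z : ℂ) => φ^[n] (affineAt (w n) z)) ψ atTop K
  conj : ∀ z ∈ upperHalf, ψ (z - (b : ℂ)) = φ (ψ z)

/-! By Julia's lemma `φ` never lowers imaginary parts, so for every δ > 0 the map `φ z - z + iδ` is
a self-map of the half-plane. Schwarz–Pick applied to it shows that on a pseudo-hyperbolic ball of
fixed radius about `z` the displacement `φ - id` oscillates by at most a constant times `(φ z).im -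
z.im`. At `z = w (n + 1)` this quantity is `y n - y (n + 1)`, which telescopes to a finite sum
because the heights converge. Thus near the sequence `φ` is a translation up to summable errors
(`IsParabolicSelfMap.norm_displacement_sub_le`).

Everything follows from this. The normalized iterates are Cauchy, uniformly on compact sets.
Consecutive horizontal steps become equal, and the limit of the steps `d` determines their size.
Suitable shifts of two sequences stay at bounded distance, and their horizontal offset converges
(`exists_tendsto_re_sub_re`), so both have the same limiting step.

The identities for `ψ` and `ψ'` then come from evaluating one limit in two ways: `tendsto_iterate`
computes the limit of `φ^[n] (q n)` from that of `q n - x n` alone. -/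

/-! ### Pseudo-hyperbolic geometry and Schwarz–Pick. -/

lemma isOpen_upperHalf : IsOpen upperHalf := isOpen_lt continuous_const Complex.continuous_im

lemma norm_sub_conj_sq (z w : ℂ) :
    ‖w - (starRingEnd ℂ) z‖ ^ 2 = ‖w - z‖ ^ 2 + 4 * z.im * w.im := by
  simp only [Complex.sq_norm, Complex.normSq_apply, Complex.sub_re, Complex.sub_im,
    Complex.conj_re, Complex.conj_im]
  ring

lemma norm_sub_conj_pos {z w : ℂ} (hz : z ∈ upperHalf) (hw : w ∈ upperHalf) :
    0 < ‖w - (starRingEnd ℂ) z‖ := by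
  have h1 : 0 < z.im := hz
  have h2 : 0 < w.im := hw
  have := norm_sub_conj_sq z w
  have h3 : 0 < ‖w - (starRingEnd ℂ) z‖ ^ 2 := by rw [this]; positivity
  exact lt_of_le_of_ne (norm_nonneg _) fun h => by simp [← h] at h3

lemma sub_conj_ne_zero {z w : ℂ} (hz : z ∈ upperHalf) (hw : w ∈ upperHalf) :
    w - (starRingEnd ℂ) z ≠ 0 := norm_pos_iff.1 (norm_sub_conj_pos hz hw)

lemma pseudoHypDist_nonneg (z w : ℂ) : 0 ≤ pseudoHypDist z w := norm_nonneg _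

lemma pseudoHypDist_sq {z w : ℂ} :
    pseudoHypDist z w ^ 2 = ‖w - z‖ ^ 2 / (‖w - z‖ ^ 2 + 4 * z.im * w.im) := by
  rw [pseudoHypDist, norm_div, div_pow, norm_sub_conj_sq]

lemma norm_sub_eq_mul {z w : ℂ} (hz : z ∈ upperHalf) (hw : w ∈ upperHalf) :
    ‖w - z‖ = pseudoHypDist z w * ‖w - (starRingEnd ℂ) z‖ := by
  rw [pseudoHypDist, norm_div, div_mul_cancel₀ _ (norm_sub_conj_pos hz hw).ne']

lemma pseudoHypDist_lt_one {z w : ℂ} (hz : z ∈ upperHalf) (hw : w ∈ upperHalf) :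
    pseudoHypDist z w < 1 := by
  have h1 : 0 < z.im := hz
  have h2 : 0 < w.im := hw
  have h : pseudoHypDist z w ^ 2 < 1 := by
    rw [pseudoHypDist_sq, div_lt_one (by positivity)]
    have : 0 < 4 * z.im * w.im := by positivity
    linarith
  nlinarith [pseudoHypDist_nonneg z w]

lemma norm_sub_conj_le {z w : ℂ} (hz : z ∈ upperHalf) :
    ‖w - (starRingEnd ℂ) z‖ ≤ ‖w - z‖ + 2 * z.im := by
  have h1 : 0 < z.im := hz
  have h : z - (starRingEnd ℂ) z = ((2 * z.im : ℝ) : ℂ) * Complex.I := Complex.sub_conj z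
  calc ‖w - (starRingEnd ℂ) z‖ = ‖(w - z) + (z - (starRingEnd ℂ) z)‖ := by ring_nf
    _ ≤ ‖w - z‖ + ‖z - (starRingEnd ℂ) z‖ := norm_add_le _ _
    _ = ‖w - z‖ + 2 * z.im := by
      rw [h, norm_mul, Complex.norm_I, mul_one, Complex.norm_real, Real.norm_of_nonneg]
      positivity

/-- Pseudo-hyperbolic balls of radius `r < 1` are contained in Euclidean balls. -/
lemma norm_sub_le_of_pseudoHypDist_le {z w : ℂ} {r : ℝ} (hz : z ∈ upperHalf)
    (hw : w ∈ upperHalf) (hr : r < 1) (h : pseudoHypDist z w ≤ r) :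
    ‖w - z‖ ≤ 2 * r / (1 - r) * z.im := by
  have h1 := norm_sub_eq_mul hz hw
  have h2 := norm_sub_conj_le (w := w) hz
  have h0 := (pseudoHypDist_nonneg z w).trans h
  have h3 : ‖w - z‖ ≤ r * (‖w - z‖ + 2 * z.im) := by
    rw [h1]
    calc _ ≤ r * ‖w - (starRingEnd ℂ) z‖ := by gcongr
      _ ≤ _ := by rw [← h1]; gcongr
  rw [div_mul_eq_mul_div, le_div_iff₀ (by linarith)]
  linarith

/-- Points at bounded distance and bounded height are uniformly close in the pseudo-hyperbolic
distance. -/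
lemma exists_pseudoHypDist_le {D m : ℝ} (hm : 0 < m) :
    ∃ r : ℝ, 0 ≤ r ∧ r < 1 ∧ ∀ z w : ℂ, m ≤ z.im → m ≤ w.im → ‖w - z‖ ≤ D →
      pseudoHypDist z w ≤ r := by
  have hlt : D ^ 2 / (D ^ 2 + 4 * m ^ 2) < 1 := by
    rw [div_lt_one (by positivity)]
    have : 0 < m ^ 2 := by positivity
    linarith
  refine ⟨Real.sqrt (D ^ 2 / (D ^ 2 + 4 * m ^ 2)), Real.sqrt_nonneg _, ?_, ?_⟩
  · rw [Real.sqrt_lt' one_pos]; simpa using hlt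
  · intro z w hz hw hD
    apply Real.le_sqrt_of_sq_le
    have h1 : m ^ 2 ≤ z.im * w.im := by nlinarith
    have h2 : ‖w - z‖ ^ 2 ≤ D ^ 2 := by gcongr
    have h3 : 0 < m ^ 2 := by positivity
    rw [pseudoHypDist_sq, div_le_div_iff₀ (by nlinarith [sq_nonneg ‖w - z‖]) (by positivity)]
    nlinarith [sq_nonneg ‖w - z‖, mul_le_mul h2 h1 h3.le (sq_nonneg D)]

/-- The Schwarz-Pick lemma in the upper half-plane. -/
lemma pseudoHypDist_map_le {f : ℂ → ℂ} (hf : DifferentiableOn ℂ f upperHalf)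
    (hm : Set.MapsTo f upperHalf upperHalf) {z w : ℂ} (hz : z ∈ upperHalf)
    (hw : w ∈ upperHalf) : pseudoHypDist (f z) (f w) ≤ pseudoHypDist z w := by
  -- Inverse Cayley map with `g 0 = z`. With the Cayley map centred at `f z` it conjugates `f` to a
  -- self-map `F` of the disc fixing 0, to which the classical Schwarz lemma applies.
  set g : ℂ → ℂ := fun ζ => (z - (starRingEnd ℂ) z * ζ) / (1 - ζ) with hg
  have hne : ∀ ζ ∈ Metric.ball (0 : ℂ) 1, 1 - ζ ≠ 0 := by
    intro ζ hζ h
    rw [mem_ball_zero_iff, ← sub_eq_zero.1 h] at hζ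
    simp at hζ
  have hg1 : ∀ ζ ∈ Metric.ball (0 : ℂ) 1,
      g ζ - z = ζ * (g ζ - (starRingEnd ℂ) z) := by
    intro ζ hζ
    have := hne ζ hζ
    simp only [hg]
    field_simp
    ring
  have hzz := norm_sub_conj_pos hz hz
  have hgm : Set.MapsTo g (Metric.ball 0 1) upperHalf := by
    intro ζ hζ
    have h1 := hne ζ hζ
    have h2 : g ζ - (starRingEnd ℂ) z = (z - (starRingEnd ℂ) z) / (1 - ζ) := by
      simp only [hg]
      field_simp
      ring
    have h3 : 0 < ‖g ζ - (starRingEnd ℂ) z‖ := by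
      rw [h2, norm_div]
      exact div_pos hzz (norm_pos_iff.2 h1)
    have h4 : ‖g ζ - z‖ = ‖ζ‖ * ‖g ζ - (starRingEnd ℂ) z‖ := by rw [hg1 ζ hζ, norm_mul]
    have h5 : ‖g ζ - z‖ < ‖g ζ - (starRingEnd ℂ) z‖ := by
      rw [h4]
      exact mul_lt_of_lt_one_left h3 (mem_ball_zero_iff.1 hζ)
    have h6 := norm_sub_conj_sq z (g ζ)
    have h7 : 0 < z.im := hz
    have h8 : 0 < z.im * (g ζ).im := by nlinarith [norm_nonneg (g ζ - z)]
    exact (pos_iff_pos_of_mul_pos h8).1 h7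
  have hgd : DifferentiableOn ℂ g (Metric.ball 0 1) := by
    apply DifferentiableOn.div (by fun_prop) (by fun_prop) hne
  set F : ℂ → ℂ := fun ζ => (f (g ζ) - f z) / (f (g ζ) - (starRingEnd ℂ) (f z)) with hF
  have hFd : DifferentiableOn ℂ F (Metric.ball 0 1) := by
    have hfg := hf.comp hgd hgm
    refine DifferentiableOn.div (hfg.sub_const _) (hfg.sub_const _) ?_
    intro ζ hζ
    exact sub_conj_ne_zero (hm hz) (hm (hgm hζ))
  have hFm : Set.MapsTo F (Metric.ball 0 1) (Metric.closedBall 0 1) := by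
    intro ζ hζ
    rw [mem_closedBall_zero_iff]
    exact (pseudoHypDist_lt_one (hm hz) (hm (hgm hζ))).le
  have hF0 : F 0 = 0 := by simp [hF, hg]
  set ζ : ℂ := (w - z) / (w - (starRingEnd ℂ) z) with hζ
  have hζ1 : ‖ζ‖ < 1 := pseudoHypDist_lt_one hz hw
  have hgζ : g ζ = w := by
    have h1 := sub_conj_ne_zero hz hw
    have h2 := sub_conj_ne_zero hz hz
    have h3 : 1 - ζ = (z - (starRingEnd ℂ) z) / (w - (starRingEnd ℂ) z) := by
      rw [hζ]; field_simp; ring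
    simp only [hg]
    rw [h3, hζ]
    field_simp
    ring
  have := Complex.norm_le_norm_of_mapsTo_ball hFd hFm hF0 hζ1
  simp only [hF, hgζ] at this
  exact this

/-! ### Parabolic self-maps: Julia's lemma and the displacement. -/

lemma IsParabolicSelfMap.iterate_mapsTo {φ : ℂ → ℂ} (hφ : IsParabolicSelfMap φ) (n : ℕ) :
    Set.MapsTo (φ^[n]) upperHalf upperHalf := hφ.mapsTo.iterate n

lemma IsParabolicSelfMap.iterate_differentiableOn {φ : ℂ → ℂ} (hφ : IsParabolicSelfMap φ)
    (n : ℕ) : DifferentiableOn ℂ (φ^[n]) upperHalf := hφ.differentiableOn.iterate hφ.mapsTo n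

/-- Julia's lemma: a parabolic self-map fixing infinity does not decrease imaginary parts. -/
lemma IsParabolicSelfMap.im_le_im {φ : ℂ → ℂ} (hφ : IsParabolicSelfMap φ) {z : ℂ}
    (hz : z ∈ upperHalf) : z.im ≤ (φ z).im := by
  have hz' : 0 < z.im := hz
  have hφz : 0 < (φ z).im := hφ.mapsTo hz
  have hray : Tendsto (fun t : ℝ => (t : ℂ) * Complex.I) atTop
      (Bornology.cobounded ℂ ⊓ 𝓟 (sectorAtInfty (Real.pi / 4))) := by
    refine tendsto_inf.2 ⟨?_, ?_⟩
    · rw [← tendsto_norm_atTop_iff_cobounded]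
      simpa using tendsto_abs_atTop_atTop
    · rw [tendsto_principal]
      filter_upwards [eventually_gt_atTop 0] with t ht
      have : ((t : ℂ) * Complex.I).arg = Real.pi / 2 := by
        rw [Complex.arg_real_mul _ ht, Complex.arg_I]
      simp only [sectorAtInfty, Set.mem_ofPred_eq, this, sub_self, abs_zero]
      positivity
  have hq := (hφ.tendsto_div (Real.pi / 4) (by positivity)
    (by linarith [Real.pi_pos])).comp hray
  set q : ℝ → ℂ := fun t => φ ((t : ℂ) * Complex.I) / ((t : ℂ) * Complex.I) with hqdef
  have hinv : Tendsto (fun t : ℝ => ((t⁻¹ : ℝ) : ℂ)) atTop (𝓝 0) := by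
    have := (Complex.continuous_ofReal.tendsto 0).comp (tendsto_inv_atTop_zero (𝕜 := ℝ))
    simpa [Function.comp_def] using this
  -- the inequality of Schwarz and Pick at `z` and `i t`, rescaled by `t`
  have key : ∀ᶠ t : ℝ in atTop,
      z.im * ‖q t * Complex.I - ((t⁻¹ : ℝ) : ℂ) * (starRingEnd ℂ) (φ z)‖ ^ 2 ≤
        (φ z).im * (q t * Complex.I).im *
          ‖Complex.I - ((t⁻¹ : ℝ) : ℂ) * (starRingEnd ℂ) z‖ ^ 2 := by
    filter_upwards [eventually_gt_atTop 0] with t ht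
    have htI : (t : ℂ) * Complex.I ∈ upperHalf := by simpa [upperHalf] using ht
    have htc : (t : ℂ) ≠ 0 := by exact_mod_cast ht.ne'
    have hp := pseudoHypDist_map_le hφ.differentiableOn hφ.mapsTo hz htI
    have hp2 := pow_le_pow_left₀ (pseudoHypDist_nonneg _ _) hp 2
    set v := φ ((t : ℂ) * Complex.I) with hv
    have hvm : 0 < v.im := hφ.mapsTo htI
    have e1 : q t * Complex.I = ((t⁻¹ : ℝ) : ℂ) * v := by
      simp only [hqdef, ← hv]
      push_cast
      field_simp
    have e2 : Complex.I = ((t⁻¹ : ℝ) : ℂ) * ((t : ℂ) * Complex.I) := by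
      push_cast
      field_simp
    have e3 : ‖q t * Complex.I - ((t⁻¹ : ℝ) : ℂ) * (starRingEnd ℂ) (φ z)‖ ^ 2 =
        (t⁻¹) ^ 2 * (‖v - φ z‖ ^ 2 + 4 * (φ z).im * v.im) := by
      rw [e1, ← mul_sub, norm_mul, mul_pow, Complex.norm_real, Real.norm_eq_abs, sq_abs,
        norm_sub_conj_sq]
    have e4 : ‖Complex.I - ((t⁻¹ : ℝ) : ℂ) * (starRingEnd ℂ) z‖ ^ 2 =
        (t⁻¹) ^ 2 * (‖(t : ℂ) * Complex.I - z‖ ^ 2 + 4 * z.im * t) := by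
      conv_lhs => rw [e2]
      rw [← mul_sub, norm_mul, mul_pow, Complex.norm_real, Real.norm_eq_abs, sq_abs,
        norm_sub_conj_sq]
      simp
    have e5 : (q t * Complex.I).im = t⁻¹ * v.im := by rw [e1, Complex.im_ofReal_mul]
    rw [e3, e4, e5]
    rw [pseudoHypDist_sq, pseudoHypDist_sq, div_le_div_iff₀ (by positivity)
      (by simp; positivity)] at hp2
    have e6 : ((t : ℂ) * Complex.I).im = t := by simp
    rw [e6] at hp2
    -- Cross-multiplied Schwarz–Pick in terms of `1 - d ^ 2`, the squared differences having
    -- cancelled. The factor `t⁻¹ ^ 3` makes both sides converge as `t → ∞`, to `z.im` and `(φ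
    -- z).im`.
    have hmain : z.im * t * (‖v - φ z‖ ^ 2 + 4 * (φ z).im * v.im) ≤
        (φ z).im * v.im * (‖(t : ℂ) * Complex.I - z‖ ^ 2 + 4 * z.im * t) := by
      nlinarith
    have ht' : 0 ≤ t⁻¹ ^ 3 := by positivity
    have := mul_le_mul_of_nonneg_left hmain ht'
    have ht1 : t⁻¹ * t = 1 := inv_mul_cancel₀ ht.ne'
    calc _ = t⁻¹ * t * (z.im * (t⁻¹ ^ 2 * (‖v - φ z‖ ^ 2 + 4 * (φ z).im * v.im))) := by
          rw [ht1, one_mul]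
      _ = t⁻¹ ^ 3 * (z.im * t * (‖v - φ z‖ ^ 2 + 4 * (φ z).im * v.im)) := by ring
      _ ≤ _ := this
      _ = _ := by ring
  have hq' : Tendsto q atTop (𝓝 1) := hq
  have hL : Tendsto (fun t : ℝ =>
      z.im * ‖q t * Complex.I - ((t⁻¹ : ℝ) : ℂ) * (starRingEnd ℂ) (φ z)‖ ^ 2) atTop
      (𝓝 (z.im * ‖1 * Complex.I - 0 * (starRingEnd ℂ) (φ z)‖ ^ 2)) :=
    ((((hq'.mul_const _).sub (hinv.mul_const _)).norm).pow 2).const_mul _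
  have hR : Tendsto (fun t : ℝ => (φ z).im * (q t * Complex.I).im *
          ‖Complex.I - ((t⁻¹ : ℝ) : ℂ) * (starRingEnd ℂ) z‖ ^ 2) atTop
      (𝓝 ((φ z).im * (1 * Complex.I).im * ‖Complex.I - 0 * (starRingEnd ℂ) z‖ ^ 2)) :=
    (((Complex.continuous_im.tendsto _).comp (hq'.mul_const _)).const_mul _).mul
      (((tendsto_const_nhds.sub (hinv.mul_const _)).norm).pow 2)
  simpa using le_of_tendsto_of_tendsto hL hR key

lemma IsParabolicSelfMap.im_le_im_iterate {φ : ℂ → ℂ} (hφ : IsParabolicSelfMap φ) (n : ℕ)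
    {z : ℂ} (hz : z ∈ upperHalf) : z.im ≤ (φ^[n] z).im := by
  induction n with
  | zero => simp
  | succ n ih =>
    rw [Function.iterate_succ_apply']
    exact ih.trans (hφ.im_le_im (hφ.iterate_mapsTo n hz))

/-- The displacement `φ z - z` of a parabolic self-map varies by at most its imaginary part on
pseudo-hyperbolic balls. -/
lemma IsParabolicSelfMap.norm_displacement_sub_le {φ : ℂ → ℂ} (hφ : IsParabolicSelfMap φ)
    {z w : ℂ} {r : ℝ} (hz : z ∈ upperHalf) (hw : w ∈ upperHalf) (hr : r < 1)
    (h : pseudoHypDist z w ≤ r) :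
    ‖(φ w - w) - (φ z - z)‖ ≤ 2 * r / (1 - r) * ((φ z).im - z.im) := by
  -- Julia's lemma gives `φ - id` only a nonnegative imaginary part; adding `iδ` makes it a genuine
  -- self-map, and δ tends to 0 at the end.
  have key : ∀ δ : ℝ, 0 < δ →
      ‖(φ w - w) - (φ z - z)‖ ≤ 2 * r / (1 - r) * ((φ z).im - z.im + δ) := by
    intro δ hδ
    set v : ℂ → ℂ := fun ζ => φ ζ - ζ + (δ : ℂ) * Complex.I with hv
    have hvim : ∀ ζ, (v ζ).im = (φ ζ).im - ζ.im + δ := by intro ζ; simp [hv]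
    have hvm : Set.MapsTo v upperHalf upperHalf := by
      intro ζ hζ
      have := hφ.im_le_im hζ
      change 0 < (v ζ).im
      rw [hvim]; linarith
    have hvd : DifferentiableOn ℂ v upperHalf :=
      (hφ.differentiableOn.sub differentiableOn_id).add_const _
    have := norm_sub_le_of_pseudoHypDist_le (hvm hz) (hvm hw) hr
      ((pseudoHypDist_map_le hvd hvm hz hw).trans h)
    rw [hvim] at this
    simpa [hv] using this
  have ht : Tendsto (fun δ : ℝ => 2 * r / (1 - r) * ((φ z).im - z.im + δ)) (𝓝[>] 0)
      (𝓝 (2 * r / (1 - r) * ((φ z).im - z.im + 0))) :=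
    ((tendsto_const_nhds.add tendsto_id).const_mul _).mono_left nhdsWithin_le_nhds
  rw [add_zero] at ht
  exact ge_of_tendsto ht (by filter_upwards [self_mem_nhdsWithin] with δ hδ using key δ hδ)

/-! ### Telescoping estimates and the asymptotics of one sequence. -/

lemma dist_le_mul_sub_of_dist_succ_le {X : Type*} [PseudoMetricSpace X] {f : ℕ → X} {y : ℕ → ℝ}
    {C : ℝ} (h : ∀ n, dist (f n) (f (n + 1)) ≤ C * (y n - y (n + 1))) {n m : ℕ} (hnm : n ≤ m) :
    dist (f n) (f m) ≤ C * (y n - y m) := by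
  induction m, hnm using Nat.le_induction with
  | base => simp
  | succ m hm ih => linarith [dist_triangle (f n) (f m) (f (m + 1)), h m]

lemma cauchySeq_of_dist_succ_le {X : Type*} [PseudoMetricSpace X] {f : ℕ → X} {y : ℕ → ℝ}
    {C L : ℝ} (hy : Tendsto y atTop (𝓝 L))
    (h : ∀ n, dist (f n) (f (n + 1)) ≤ C * (y n - y (n + 1))) : CauchySeq f := by
  have hc : CauchySeq (fun n => C * y n) := (hy.const_mul C).cauchySeq
  rw [Metric.cauchySeq_iff'] at hc ⊢
  intro ε hε
  obtain ⟨N, hN⟩ := hc ε hε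
  refine ⟨N, fun n hn => ?_⟩
  have h1 := dist_le_mul_sub_of_dist_succ_le h hn
  have h2 := hN n hn
  rw [Real.dist_eq, abs_lt] at h2
  rw [dist_comm]
  linarith

lemma IsBISBS.iterate_map {φ : ℂ → ℂ} {w : ℕ → ℂ} (hw : IsBISBS φ w) (n k : ℕ) :
    φ^[k] (w (k + n)) = w n := by
  induction k with
  | zero => simp
  | succ k ih =>
    rw [Function.iterate_succ_apply, show k + 1 + n = k + n + 1 by omega, hw.map_succ, ih]

namespace IsNonzeroHeightBISBS

variable {φ : ℂ → ℂ} {w : ℕ → ℂ} {a ℓ : ℝ}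

lemma im_pos (hw : IsNonzeroHeightBISBS φ w a ℓ) (n : ℕ) : 0 < (w n).im := hw.mem n

lemma antitone_im (hφ : IsParabolicSelfMap φ) (hw : IsNonzeroHeightBISBS φ w a ℓ) :
    Antitone (fun n => (w n).im) := by
  refine antitone_nat_of_succ_le fun n => ?_
  have := hφ.im_le_im (hw.mem (n + 1))
  rwa [hw.map_succ] at this

lemma height_le_im (hφ : IsParabolicSelfMap φ) (hw : IsNonzeroHeightBISBS φ w a ℓ) (n : ℕ) :
    ℓ ≤ (w n).im := (hw.antitone_im hφ).le_of_tendsto hw.tendsto_im n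

lemma step_lt_one (hw : IsNonzeroHeightBISBS φ w a ℓ) : a < 1 := by
  obtain ⟨c, hc, h⟩ := hw.bounded_steps
  exact (le_of_tendsto' hw.tendsto_step h).trans_lt hc

lemma step_nonneg (hw : IsNonzeroHeightBISBS φ w a ℓ) : 0 ≤ a :=
  ge_of_tendsto' hw.tendsto_step fun _ => pseudoHypDist_nonneg _ _

/-- Steps increase by Schwarz–Pick, so a limit `a ≤ 0` would make every step vanish and the sequence
constant, contrary to `w n → ∞`. -/
lemma step_pos (hφ : IsParabolicSelfMap φ) (hw : IsNonzeroHeightBISBS φ w a ℓ) : 0 < a := by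
  by_contra h
  have hmono : Monotone (fun n => pseudoHypDist (w n) (w (n + 1))) := by
    refine monotone_nat_of_le_succ fun n => ?_
    have := pseudoHypDist_map_le hφ.differentiableOn hφ.mapsTo (hw.mem (n + 1)) (hw.mem (n + 2))
    rwa [hw.map_succ, hw.map_succ] at this
  have hconst : ∀ n, w n = w 0 := by
    intro n
    induction n with
    | zero => rfl
    | succ n ih =>
      have h1 : pseudoHypDist (w n) (w (n + 1)) = 0 :=
        le_antisymm ((hmono.ge_of_tendsto hw.tendsto_step n).trans (not_lt.1 h))
          (pseudoHypDist_nonneg _ _)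
      have h2 := norm_sub_eq_mul (hw.mem n) (hw.mem (n + 1))
      rw [h1, zero_mul, norm_eq_zero, sub_eq_zero] at h2
      rw [h2, ih]
  have h1 := tendsto_norm_atTop_iff_cobounded.2 hw.tendsto_infty
  simp only [hconst] at h1
  exact not_tendsto_const_atTop _ _ h1

lemma translationLength_pos (hφ : IsParabolicSelfMap φ) (hw : IsNonzeroHeightBISBS φ w a ℓ) :
    0 < translationLength a := by
  have h0 := hw.step_pos hφ
  have h1 := hw.step_lt_one
  have : 0 < 1 - a ^ 2 := by nlinarith
  unfold translationLength
  positivity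

lemma tendsto_re (hw : IsNonzeroHeightBISBS φ w a ℓ) :
    Tendsto (fun n => (w n).re) atTop atTop := by
  have h1 := tendsto_norm_atTop_iff_cobounded.2 hw.tendsto_infty
  have h2 : Tendsto (fun n => Real.cos (w n).arg) atTop (𝓝 1) := by
    simpa [Function.comp_def] using (Real.continuous_cos.tendsto 0).comp hw.tendsto_arg
  simpa [Complex.norm_mul_cos_arg] using h1.atTop_mul_pos one_pos h2

/-- The displacement at points near the sequence is controlled by the decrease of the heights. -/
lemma norm_displacement_sub_le (hφ : IsParabolicSelfMap φ) (hw : IsNonzeroHeightBISBS φ w a ℓ)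
    {z : ℂ} {r : ℝ} {n : ℕ} (hz : z ∈ upperHalf) (hr : r < 1)
    (h : pseudoHypDist (w (n + 1)) z ≤ r) :
    ‖(φ z - z) - (w n - w (n + 1))‖ ≤ 2 * r / (1 - r) * ((w n).im - (w (n + 1)).im) := by
  have := hφ.norm_displacement_sub_le (hw.mem (n + 1)) hz hr h
  rwa [hw.map_succ] at this

lemma tendsto_im_sub (hw : IsNonzeroHeightBISBS φ w a ℓ) :
    Tendsto (fun n => (w n).im - (w (n + 1)).im) atTop (𝓝 0) := by
  simpa using hw.tendsto_im.sub (hw.tendsto_im.comp (tendsto_add_atTop_nat 1))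

/-- Consecutive steps are, up to sign, displacements of `φ` at `w (n + 1)` and `w (n + 2)`, points
within the step bound `c` of each other. -/
lemma tendsto_re_sub_succ (hφ : IsParabolicSelfMap φ) (hw : IsNonzeroHeightBISBS φ w a ℓ) :
    Tendsto (fun n => ((w (n + 2)).re - (w (n + 1)).re) - ((w (n + 1)).re - (w n).re)) atTop
      (𝓝 0) := by
  obtain ⟨c, hc, h⟩ := hw.bounded_steps
  have hlim := hw.tendsto_im_sub.const_mul (2 * c / (1 - c))
  rw [mul_zero] at hlim
  refine squeeze_zero_norm (fun n => ?_) hlim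
  have := hw.norm_displacement_sub_le hφ (hw.mem (n + 2)) hc (h (n + 1))
  rw [hw.map_succ] at this
  refine le_trans ?_ this
  rw [Real.norm_eq_abs]
  have h3 := Complex.abs_re_le_norm (w (n + 1) - w (n + 2) - (w n - w (n + 1)))
  refine le_trans (le_of_eq ?_) h3
  rw [← abs_neg]
  simp only [Complex.sub_re]
  ring_nf

/-- The formula for `d ^ 2` is solved for the squared horizontal step. This leaves the sign open. -/
lemma tendsto_sq_re_sub (hw : IsNonzeroHeightBISBS φ w a ℓ) :
    Tendsto (fun n => ((w (n + 1)).re - (w n).re) ^ 2) atTop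
      (𝓝 ((ℓ * translationLength a) ^ 2)) := by
  have h1 := hw.step_lt_one
  have h0 := hw.step_nonneg
  have hpos : 0 < 1 - a ^ 2 := by nlinarith
  have hy1 := hw.tendsto_im.comp (tendsto_add_atTop_nat 1)
  have hd2 := hw.tendsto_step.pow 2
  have hlim : Tendsto (fun n =>
      (pseudoHypDist (w n) (w (n + 1)) ^ 2 * ((w n).im + (w (n + 1)).im) ^ 2 -
        ((w n).im - (w (n + 1)).im) ^ 2) / (1 - pseudoHypDist (w n) (w (n + 1)) ^ 2)) atTop
      (𝓝 ((a ^ 2 * (ℓ + ℓ) ^ 2 - 0 ^ 2) / (1 - a ^ 2))) :=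
    ((hd2.mul ((hw.tendsto_im.add hy1).pow 2)).sub (hw.tendsto_im_sub.pow 2)).div
      (tendsto_const_nhds.sub hd2) hpos.ne'
  have hval : (a ^ 2 * (ℓ + ℓ) ^ 2 - 0 ^ 2) / (1 - a ^ 2) = (ℓ * translationLength a) ^ 2 := by
    rw [translationLength, mul_pow, div_pow, Real.sq_sqrt hpos.le]
    ring
  rw [hval] at hlim
  refine hlim.congr fun n => ?_
  have hd := pseudoHypDist_lt_one (hw.mem n) (hw.mem (n + 1))
  have hd0 := pseudoHypDist_nonneg (w n) (w (n + 1))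
  have hden : 1 - pseudoHypDist (w n) (w (n + 1)) ^ 2 ≠ 0 := by
    have : 0 < 1 - pseudoHypDist (w n) (w (n + 1)) ^ 2 := by nlinarith
    exact this.ne'
  have hyn := hw.im_pos n
  have hyn1 := hw.im_pos (n + 1)
  rw [div_eq_iff hden]
  have hden2 : ‖w (n + 1) - w n‖ ^ 2 + 4 * (w n).im * (w (n + 1)).im ≠ 0 := by positivity
  have hsq := pseudoHypDist_sq (z := w n) (w := w (n + 1))
  rw [eq_div_iff hden2] at hsq
  have hn : ‖w (n + 1) - w n‖ ^ 2 =
      ((w (n + 1)).re - (w n).re) ^ 2 + ((w n).im - (w (n + 1)).im) ^ 2 := by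
    rw [Complex.sq_norm, Complex.normSq_apply, Complex.sub_re, Complex.sub_im]
    ring
  rw [hn] at hsq
  linear_combination hsq

/-- The horizontal steps converge to `ℓ` times the translation length. -/
lemma tendsto_re_sub (hφ : IsParabolicSelfMap φ) (hw : IsNonzeroHeightBISBS φ w a ℓ) :
    Tendsto (fun n => (w (n + 1)).re - (w n).re) atTop (𝓝 (ℓ * translationLength a)) := by
  set s := ℓ * translationLength a with hs
  have hspos : 0 < s := mul_pos hw.height_pos (hw.translationLength_pos hφ)
  set D : ℕ → ℝ := fun n => (w (n + 1)).re - (w n).re with hD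
  have habs : Tendsto (fun n => |D n|) atTop (𝓝 s) := by
    have := hw.tendsto_sq_re_sub.sqrt
    simpa [Real.sqrt_sq_eq_abs, ← hs, abs_of_pos hspos] using this
  have hdiff : Tendsto (fun n => D (n + 1) - D n) atTop (𝓝 0) := hw.tendsto_re_sub_succ hφ
  have hev : ∀ᶠ n in atTop, s / 2 < |D n| ∧ |D (n + 1) - D n| < s / 2 :=
    (habs.eventually (lt_mem_nhds (half_lt_self hspos))).and
      ((by simpa using hdiff.abs : Tendsto (fun n => |D (n + 1) - D n|) atTop (𝓝 0)).eventually
        (gt_mem_nhds (half_pos hspos)))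
  obtain ⟨N, hN⟩ := eventually_atTop.1 hev
  -- Past `N` the step exceeds `s / 2` in absolute value and changes by less than `s / 2`, so its
  -- sign is frozen; it is positive because `x n → ∞`.
  have hpos : ∃ n ≥ N, 0 < D n := by
    by_contra! hneg
    have hle : ∀ n ≥ N, (w n).re ≤ (w N).re := by
      intro n hn
      induction n, hn using Nat.le_induction with
      | base => exact le_rfl
      | succ n hn ih => linarith [hneg n hn, show D n = (w (n + 1)).re - (w n).re from rfl]
    obtain ⟨n, hn, hgt⟩ := ((eventually_ge_atTop N).and
      (hw.tendsto_re.eventually (eventually_gt_atTop (w N).re))).exists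
    exact absurd (hle n hn) (not_le.2 hgt)
  obtain ⟨n₀, hn₀, hn₀pos⟩ := hpos
  have hall : ∀ n ≥ n₀, 0 < D n := by
    intro n hn
    induction n, hn using Nat.le_induction with
    | base => exact hn₀pos
    | succ n hn ih =>
      obtain ⟨h1, h2⟩ := hN n (hn₀.trans hn)
      rw [abs_of_pos ih] at h1
      linarith [(abs_lt.1 h2).1]
  refine habs.congr' ?_
  filter_upwards [eventually_ge_atTop n₀] with n hn using abs_of_pos (hall n hn)

lemma tendsto_re_add_sub (hφ : IsParabolicSelfMap φ) (hw : IsNonzeroHeightBISBS φ w a ℓ)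
    (j : ℕ) : Tendsto (fun n => (w (n + j)).re - (w n).re) atTop
      (𝓝 (j * (ℓ * translationLength a))) := by
  induction j with
  | zero => simp
  | succ j ih =>
    have h := ((hw.tendsto_re_sub hφ).comp (tendsto_add_atTop_nat j)).add ih
    convert h using 2 with n
    · simp [add_assoc]
    · push_cast; ring

end IsNonzeroHeightBISBS

/-! ### Comparison of two sequences. -/

/-- The horizontal steps of two backward-iteration sequences which stay at bounded distance differ
by a telescoping error, so suitable shifts of the sequences are asymptotically a horizontal
translation of each other. -/
lemma exists_tendsto_re_sub_re {φ : ℂ → ℂ} (hφ : IsParabolicSelfMap φ) {w w' : ℕ → ℂ}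
    {a a' ℓ ℓ' : ℝ} (hw : IsNonzeroHeightBISBS φ w a ℓ) (hw' : IsNonzeroHeightBISBS φ w' a' ℓ') :
    ∃ (N m : ℕ) (c : ℝ),
      Tendsto (fun k => (w' (k + N)).re - (w (k + m)).re) atTop (𝓝 c) := by
  obtain ⟨B, hB, hB'⟩ : ∃ B : ℝ, (∀ n, |(w (n + 1)).re - (w n).re| ≤ B) ∧
      ∀ n, |(w' (n + 1)).re - (w' n).re| ≤ B := by
    obtain ⟨B₁, h₁⟩ := (hw.tendsto_re_sub hφ).abs.bddAbove_range
    obtain ⟨B₂, h₂⟩ := (hw'.tendsto_re_sub hφ).abs.bddAbove_range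
    exact ⟨max B₁ B₂, fun n => (h₁ ⟨n, rfl⟩).trans (le_max_left _ _),
      fun n => (h₂ ⟨n, rfl⟩).trans (le_max_right _ _)⟩
  have hB0 : 0 ≤ B := (abs_nonneg _).trans (hB 0)
  -- Budget for the horizontal gap: `B` for the initial offset, 1 for all later telescoping errors,
  -- `2 * B` for one crude step. The initial heights bound the vertical gap.
  obtain ⟨r, hr0, hr1, hr⟩ := exists_pseudoHypDist_le (D := 3 * B + 1 + ((w 0).im + (w' 0).im))
    (lt_min hw.height_pos hw'.height_pos)
  set C := 2 * r / (1 - r) with hC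
  have hC0 : 0 ≤ C := div_nonneg (by linarith) (by linarith)
  obtain ⟨M, hM⟩ : ∃ M, C * ((w M).im - ℓ) ≤ 1 := by
    have h : Tendsto (fun n => C * ((w n).im - ℓ)) atTop (𝓝 0) := by
      simpa using (hw.tendsto_im.sub_const ℓ).const_mul C
    obtain ⟨M, hM⟩ := (h.eventually (gt_mem_nhds one_pos)).exists
    exact ⟨M, hM.le⟩
  obtain ⟨N, hN⟩ := (hw'.tendsto_re.eventually (eventually_ge_atTop (w M).re)).exists
  -- `w m` is the last point before the tail of `w` first passes `w' N`, so their gap is at most one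
  -- step.
  obtain ⟨m, hMm, hm⟩ : ∃ m, M ≤ m ∧ |(w' N).re - (w m).re| ≤ B := by
    classical
    have hex : ∃ j, (w' N).re < (w (M + j + 1)).re := by
      have := hw.tendsto_re.comp (tendsto_add_atTop_nat (M + 1))
      obtain ⟨j, hj⟩ := (this.eventually (eventually_gt_atTop (w' N).re)).exists
      exact ⟨j, by simpa [add_comm, add_left_comm, add_assoc] using hj⟩
    refine ⟨M + Nat.find hex, Nat.le_add_right _ _, ?_⟩
    have h1 := Nat.find_spec hex
    have h2 : (w (M + Nat.find hex)).re ≤ (w' N).re := by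
      rcases hj : Nat.find hex with _ | j
      · simpa using hN
      · exact not_lt.1 (Nat.find_min hex (by omega : j < Nat.find hex))
    have h3 := (abs_le.1 (hB (M + Nat.find hex))).2
    rw [abs_of_nonneg (by linarith)]
    linarith
  set D : ℕ → ℝ := fun k => (w' (k + N)).re - (w (k + m)).re with hD
  have him := hw.antitone_im hφ
  have him' := hw'.antitone_im hφ
  -- The hypothesis concerns `k + 1`, since displacements are compared there and `φ` lowers the
  -- index. The induction in `hbound` supplies it by a bootstrap: the crude bound `2 * B` on one
  -- change of gap puts `D (k + 1)` within the budget, and the sharp estimate then restores the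
  -- telescoping bound.
  have hstep : ∀ k, |D (k + 1)| ≤ 3 * B + 1 →
      |D (k + 1) - D k| ≤ C * ((w (k + m)).im - (w (k + m + 1)).im) := by
    intro k hk
    rw [show D (k + 1) = (w' (k + N + 1)).re - (w (k + m + 1)).re by
      simp only [hD, add_right_comm]] at hk ⊢
    have hdist : pseudoHypDist (w (k + m + 1)) (w' (k + N + 1)) ≤ r := by
      refine hr _ _ ((min_le_left _ _).trans (hw.height_le_im hφ _))
        ((min_le_right _ _).trans (hw'.height_le_im hφ _)) ?_
      refine (Complex.norm_le_abs_re_add_abs_im _).trans (add_le_add ?_ ?_)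
      · simpa using hk
      · rw [Complex.sub_im, abs_le]
        have e1 := him (Nat.zero_le (k + m + 1))
        have e2 := him' (Nat.zero_le (k + N + 1))
        have e3 := hw.im_pos (k + m + 1)
        have e4 := hw'.im_pos (k + N + 1)
        simp only at e1 e2
        constructor <;> linarith
    have h := hw.norm_displacement_sub_le hφ (hw'.mem _) hr1 hdist
    rw [hw'.map_succ] at h
    refine le_trans (le_of_eq ?_) ((Complex.abs_re_le_norm _).trans h)
    rw [← abs_neg]
    simp only [hD, Complex.sub_re]
    ring_nf
  have hbound : ∀ k, |D k| ≤ B + C * ((w m).im - (w (k + m)).im) := by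
    intro k
    induction k with
    | zero => simpa [hD] using hm
    | succ k ih =>
      have e1 : |D (k + 1) - D k| ≤ 2 * B := by
        have e2 := abs_le.1 (hB (k + m))
        have e3 := abs_le.1 (hB' (k + N))
        simp only [hD, add_right_comm k 1]
        rw [abs_le]
        constructor <;> linarith [e2.1, e2.2, e3.1, e3.2]
      have e4 : C * ((w m).im - (w (k + m)).im) ≤ 1 := by
        refine (mul_le_mul_of_nonneg_left ?_ hC0).trans hM
        have := him hMm
        simp only at this
        linarith [hw.height_le_im hφ (k + m)]
      have e5 : |D (k + 1)| ≤ |D k| + |D (k + 1) - D k| := by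
        have := abs_add_le (D k) (D (k + 1) - D k)
        rwa [add_sub_cancel] at this
      have e6 := hstep k (by linarith)
      rw [add_right_comm k 1]
      linarith
  have hcauchy : CauchySeq D := by
    refine cauchySeq_of_dist_succ_le (y := fun k => (w (k + m)).im) (C := C)
      (hw.tendsto_im.comp (tendsto_add_atTop_nat m)) fun k => ?_
    rw [dist_comm, Real.dist_eq]
    have e4 : C * ((w m).im - (w (k + 1 + m)).im) ≤ 1 := by
      refine (mul_le_mul_of_nonneg_left ?_ hC0).trans hM
      have := him hMm
      simp only at this
      linarith [hw.height_le_im hφ (k + 1 + m)]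
    have := hstep k (by linarith [hbound (k + 1)])
    rwa [add_right_comm k 1]
  obtain ⟨c, hc⟩ := cauchySeq_tendsto_of_complete hcauchy
  exact ⟨N, m, c, hc⟩

/-- Two sequences of non-zero height have the same limit step, and are asymptotically a
horizontal translation of each other. -/
lemma height_mul_eq_and_exists_tendsto {φ : ℂ → ℂ} (hφ : IsParabolicSelfMap φ) {w w' : ℕ → ℂ}
    {a a' ℓ ℓ' : ℝ} (hw : IsNonzeroHeightBISBS φ w a ℓ) (hw' : IsNonzeroHeightBISBS φ w' a' ℓ') :
    ℓ * translationLength a = ℓ' * translationLength a' ∧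
      ∃ c : ℝ, Tendsto (fun n => (w n).re - (w' n).re) atTop (𝓝 c) := by
  obtain ⟨N, m, c, hc⟩ := exists_tendsto_re_sub_re hφ hw hw'
  constructor
  -- The increments of the convergent offset tend to 0, and also to the difference of the two
  -- limiting steps.
  · have h1 := ((hw'.tendsto_re_sub hφ).comp (tendsto_add_atTop_nat N)).sub
      ((hw.tendsto_re_sub hφ).comp (tendsto_add_atTop_nat m))
    have h2 := (hc.comp (tendsto_add_atTop_nat 1)).sub hc
    have h3 := tendsto_nhds_unique (h1.congr fun k => ?_) h2
    · linarith
    · simp only [Function.comp_apply, add_right_comm k 1]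
      ring
  · refine ⟨_, (((hw'.tendsto_re_add_sub hφ N).sub (hw.tendsto_re_add_sub hφ m)).sub hc).congr
      fun k => ?_⟩
    ring

/-! ### Convergence of the normalized iterates and the functional equation. -/

lemma affineAt_im (p z : ℂ) : (affineAt p z).im = p.im * z.im := by simp [affineAt]

lemma affineAt_I (p : ℂ) : affineAt p Complex.I = p := Complex.re_add_im p

lemma affineAt_mapsTo {p : ℂ} (hp : p ∈ upperHalf) :
    Set.MapsTo (affineAt p) upperHalf upperHalf := by
  intro z hz
  change 0 < (affineAt p z).im
  rw [affineAt_im]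
  exact mul_pos hp hz

lemma affineAt_sub_self (p z : ℂ) : affineAt p z - p = p.im * (z - Complex.I) := by
  conv_lhs => rw [← affineAt_I p]
  simp only [affineAt, Complex.add_re, Complex.ofReal_re, Complex.mul_re, Complex.I_re, mul_zero,
    Complex.ofReal_im, Complex.I_im, mul_one, sub_self, add_zero, Complex.add_im, Complex.mul_im,
    zero_add]
  ring

lemma exists_bounds_of_isCompact {K : Set ℂ} (hK : IsCompact K) (hKU : K ⊆ upperHalf) :
    ∃ m R : ℝ, 0 < m ∧ m ≤ 1 ∧ 0 ≤ R ∧ ∀ z ∈ K, m ≤ z.im ∧ ‖z - Complex.I‖ ≤ R := by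
  obtain ⟨m, hm, hmK⟩ := hK.exists_forall_le' (f := Complex.im) (a := 0)
    Complex.continuous_im.continuousOn hKU
  obtain ⟨R, hR⟩ := hK.exists_bound_of_continuousOn (f := fun z => z - Complex.I)
    (by fun_prop)
  exact ⟨min m 1, max R 0, lt_min hm one_pos, min_le_right _ _, le_max_right _ _,
    fun z hz => ⟨(min_le_left _ _).trans (hmK z hz), (hR z hz).trans (le_max_left _ _)⟩⟩

namespace IsNonzeroHeightBISBS

variable {φ : ℂ → ℂ} {w : ℕ → ℂ} {a ℓ : ℝ}

lemma exists_pseudoHypDist_affineAt_le (hφ : IsParabolicSelfMap φ)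
    (hw : IsNonzeroHeightBISBS φ w a ℓ) {m R : ℝ} (hm : 0 < m) (hm1 : m ≤ 1) :
    ∃ r : ℝ, 0 ≤ r ∧ r < 1 ∧ ∀ z : ℂ, m ≤ z.im → ‖z - Complex.I‖ ≤ R → ∀ n,
      pseudoHypDist (w n) (affineAt (w n) z) ≤ r := by
  obtain ⟨r, hr0, hr1, hr⟩ := exists_pseudoHypDist_le (D := (w 0).im * R)
    (mul_pos hw.height_pos hm)
  refine ⟨r, hr0, hr1, fun z hz hzR n => hr _ _ ?_ ?_ ?_⟩
  · exact (mul_le_of_le_one_right hw.height_pos.le hm1).trans (hw.height_le_im hφ n)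
  · rw [affineAt_im]
    exact mul_le_mul (hw.height_le_im hφ n) hz hm.le (hw.im_pos n).le
  · rw [affineAt_sub_self, norm_mul, Complex.norm_real, Real.norm_of_nonneg (hw.im_pos n).le]
    exact mul_le_mul (hw.antitone_im hφ (Nat.zero_le n)) hzR (norm_nonneg _) (hw.im_pos 0).le

/-- Consecutive normalized iterates differ by a multiple of the decrease of the heights. -/
lemma exists_dist_normalized_le (hφ : IsParabolicSelfMap φ) (hw : IsNonzeroHeightBISBS φ w a ℓ)
    {m R : ℝ} (hm : 0 < m) (hm1 : m ≤ 1) (hR : 0 ≤ R) :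
    ∃ C : ℝ, ∀ z : ℂ, m ≤ z.im → ‖z - Complex.I‖ ≤ R → ∀ n,
      dist (φ^[n] (affineAt (w n) z)) (φ^[n + 1] (affineAt (w (n + 1)) z)) ≤
        C * ((w n).im - (w (n + 1)).im) := by
  obtain ⟨r, hr0, hr1, hr⟩ := hw.exists_pseudoHypDist_affineAt_le hφ (R := R) hm hm1
  set c := 2 * r / (1 - r) with hc
  have hc0 : 0 ≤ c := div_nonneg (by linarith) (by linarith)
  set Q := c * (w 0).im with hQ
  have hQ0 : 0 ≤ Q := mul_nonneg hc0 (hw.im_pos 0).le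
  have hℓm : 0 < ℓ * m := mul_pos hw.height_pos hm
  -- The first factor bounds `d(p, q) / ε`; the second bounds the denominator of `d` after applying
  -- `φ^[n]`, turning it back into Euclidean distance.
  refine ⟨(c + R) / (ℓ * m) * (2 * Q + 2 * ((w 0).im + Q)), fun z hz hzR n => ?_⟩
  have hzU : z ∈ upperHalf := hm.trans_le hz
  have hτ : ∀ k, affineAt (w k) z ∈ upperHalf := fun k => affineAt_mapsTo (hw.mem k) hzU
  have hψ : ∀ k, φ^[k] (affineAt (w k) z) ∈ upperHalf := fun k => hφ.iterate_mapsTo k (hτ k)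
  -- `φ^[k]` sends `w k` to `w 0`, so Schwarz–Pick confines all normalized iterates to one ball
  -- about `w 0`.
  have hnear : ∀ k, ‖φ^[k] (affineAt (w k) z) - w 0‖ ≤ Q := by
    intro k
    refine norm_sub_le_of_pseudoHypDist_le (hw.mem 0) (hψ k) hr1 ?_
    have := pseudoHypDist_map_le (hφ.iterate_differentiableOn k) (hφ.iterate_mapsTo k)
      (hw.mem k) (hτ k)
    rw [show φ^[k] (w k) = w 0 from hw.iterate_map 0 k] at this
    exact this.trans (hr z hz hzR k)
  set ε := (w n).im - (w (n + 1)).im with hε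
  have hε0 : 0 ≤ ε := sub_nonneg.2 (hw.antitone_im hφ (Nat.le_succ n))
  set p := affineAt (w n) z with hp
  set q := φ (affineAt (w (n + 1)) z) with hq
  have hqU : q ∈ upperHalf := hφ.mapsTo (hτ (n + 1))
  -- Translating `affineAt (w (n + 1)) z` by `w n - w (n + 1)` misses `p` only by `-ε (z - i)`; this
  -- accounts for `R`, the displacement estimate for `c`.
  have hpq : ‖q - p‖ ≤ (c + R) * ε := by
    have h1 := hw.norm_displacement_sub_le hφ (hτ (n + 1)) hr1 (hr z hz hzR (n + 1))
    have h2 : q - p = (φ (affineAt (w (n + 1)) z) - affineAt (w (n + 1)) z -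
        (w n - w (n + 1))) + ((-ε : ℝ) : ℂ) * (z - Complex.I) := by
      have e1 := affineAt_sub_self (w (n + 1)) z
      have e2 := affineAt_sub_self (w n) z
      rw [← hp] at e2
      simp only [hε]
      push_cast
      linear_combination e1 - e2
    rw [h2]
    refine (norm_add_le _ _).trans ?_
    rw [norm_mul, Complex.norm_real, norm_neg, Real.norm_of_nonneg hε0, add_mul]
    refine add_le_add h1 ?_
    rw [mul_comm]
    gcongr
  have hd : pseudoHypDist p q ≤ (c + R) * ε / (ℓ * m) := by
    rw [pseudoHypDist, norm_div]
    refine div_le_div₀ (by positivity) hpq hℓm ?_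
    have h3 := Complex.abs_im_le_norm (q - (starRingEnd ℂ) p)
    have h4 : (q - (starRingEnd ℂ) p).im = q.im + p.im := by simp
    have h5 : ℓ * m ≤ p.im := by
      rw [hp, affineAt_im]
      exact mul_le_mul (hw.height_le_im hφ n) hz hm.le (hw.im_pos n).le
    have h6 : 0 < q.im := hqU
    rw [h4] at h3
    linarith [le_abs_self (q.im + p.im)]
  have hd' : pseudoHypDist (φ^[n] p) (φ^[n] q) ≤ (c + R) * ε / (ℓ * m) :=
    (pseudoHypDist_map_le (hφ.iterate_differentiableOn n) (hφ.iterate_mapsTo n) (hτ n) hqU).trans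
      hd
  have hsucc : φ^[n + 1] (affineAt (w (n + 1)) z) = φ^[n] q := Function.iterate_succ_apply _ _ _
  have hn1 := hnear n
  have hn2 := hnear (n + 1)
  rw [hsucc] at hn2
  rw [hsucc, dist_comm, dist_eq_norm,
    norm_sub_eq_mul (hφ.iterate_mapsTo n (hτ n)) (hφ.iterate_mapsTo n hqU)]
  have hden : ‖φ^[n] q - (starRingEnd ℂ) (φ^[n] p)‖ ≤ 2 * Q + 2 * ((w 0).im + Q) := by
    refine (norm_sub_conj_le (hφ.iterate_mapsTo n (hτ n))).trans (add_le_add ?_ ?_)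
    · have := norm_sub_le_norm_sub_add_norm_sub (φ^[n] q) (w 0) (φ^[n] p)
      rw [norm_sub_rev (w 0)] at this
      linarith
    · have := (Complex.abs_im_le_norm (φ^[n] p - w 0)).trans hn1
      rw [Complex.sub_im] at this
      linarith [(abs_le.1 this).2]
  calc _ ≤ (c + R) * ε / (ℓ * m) * (2 * Q + 2 * ((w 0).im + Q)) :=
        mul_le_mul hd' hden (norm_nonneg _) (by positivity)
    _ = _ := by ring

/-- The normalized iterates converge uniformly on compact sets. -/
lemma exists_tendstoUniformlyOn (hφ : IsParabolicSelfMap φ) (hw : IsNonzeroHeightBISBS φ w a ℓ) :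
    ∃ ψ : ℂ → ℂ, ∀ K : Set ℂ, K ⊆ upperHalf → IsCompact K →
      TendstoUniformlyOn (fun (n : ℕ) (z : ℂ) => φ^[n] (affineAt (w n) z)) ψ atTop K := by
  refine ⟨fun z => limUnder atTop fun n => φ^[n] (affineAt (w n) z), fun K hKU hK => ?_⟩
  obtain ⟨m, R, hm, hm1, hR, hmK⟩ := exists_bounds_of_isCompact hK hKU
  obtain ⟨C, hC⟩ := hw.exists_dist_normalized_le hφ hm hm1 hR
  rw [Metric.tendstoUniformlyOn_iff]
  intro ε hε
  have hlim : Tendsto (fun n => C * ((w n).im - ℓ)) atTop (𝓝 0) := by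
    simpa using (hw.tendsto_im.sub_const ℓ).const_mul C
  filter_upwards [hlim.eventually (gt_mem_nhds hε)] with n hn z hz
  have hdist := hC z (hmK z hz).1 (hmK z hz).2
  have hz' := CauchySeq.tendsto_limUnder
    (cauchySeq_of_dist_succ_le (y := fun n => (w n).im) hw.tendsto_im hdist)
  refine lt_of_le_of_lt ?_ hn
  rw [dist_comm]
  refine le_of_tendsto_of_tendsto (tendsto_const_nhds.dist hz')
    ((tendsto_const_nhds.sub hw.tendsto_im).const_mul C) ?_
  filter_upwards [eventually_ge_atTop n] with k hk
  exact dist_le_mul_sub_of_dist_succ_le (y := fun n => (w n).im) hdist hk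

/-- Limits of iterates along sequences whose normalizations converge. -/
lemma tendsto_iterate (hw : IsNonzeroHeightBISBS φ w a ℓ) {ψ : ℂ → ℂ}
    (hψc : ContinuousOn ψ upperHalf)
    (hψ : ∀ K : Set ℂ, K ⊆ upperHalf → IsCompact K →
      TendstoUniformlyOn (fun (n : ℕ) (z : ℂ) => φ^[n] (affineAt (w n) z)) ψ atTop K)
    {q : ℕ → ℂ} {p : ℂ} (hp : p ∈ upperHalf)
    (hq : Tendsto (fun n => q n - ((w n).re : ℂ)) atTop (𝓝 (ℓ * p))) :
    Tendsto (fun n => φ^[n] (q n)) atTop (𝓝 (ψ p)) := by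
  have hloc := (tendstoLocallyUniformlyOn_iff_forall_isCompact isOpen_upperHalf).2 hψ
  have hℓ : (ℓ : ℂ) ≠ 0 := by exact_mod_cast hw.height_pos.ne'
  have hlim : Tendsto (fun n => (q n - ((w n).re : ℂ)) / ((w n).im : ℂ)) atTop (𝓝 p) := by
    have := hq.div ((Complex.continuous_ofReal.tendsto ℓ).comp hw.tendsto_im) hℓ
    rwa [mul_div_cancel_left₀ _ hℓ] at this
  have hlim' : Tendsto (fun n => (q n - ((w n).re : ℂ)) / ((w n).im : ℂ)) atTop
      (𝓝[upperHalf] p) := by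
    rwa [isOpen_upperHalf.nhdsWithin_eq hp]
  have := hloc.tendsto_comp (hψc p hp) hp hlim'
  refine this.congr fun n => ?_
  have him : ((w n).im : ℂ) ≠ 0 := by exact_mod_cast (hw.im_pos n).ne'
  rw [affineAt, mul_div_cancel₀ _ him, add_sub_cancel]

/-- Julia's lemma gives `(ψ z).im ≥ ℓ * z.im`, so the limit does not reach the boundary. The
functional equation comes from reading `φ^[n + 1] (affineAt (w n) z)` as `φ` after `n` iterates, or
as `n + 1` iterates normalized by `w (n + 1)`. -/
lemma exists_isConjugation (hφ : IsParabolicSelfMap φ) (hw : IsNonzeroHeightBISBS φ w a ℓ) :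
    ∃ ψ, IsConjugation φ w (translationLength a) ψ := by
  obtain ⟨ψ, hψ⟩ := hw.exists_tendstoUniformlyOn hφ
  have hloc := (tendstoLocallyUniformlyOn_iff_forall_isCompact isOpen_upperHalf).2 hψ
  have hdiff : DifferentiableOn ℂ ψ upperHalf := by
    refine hloc.differentiableOn (Eventually.of_forall fun n => ?_) isOpen_upperHalf
    refine (hφ.iterate_differentiableOn n).comp ?_ (affineAt_mapsTo (hw.mem n))
    unfold affineAt
    fun_prop
  have hmaps : Set.MapsTo ψ upperHalf upperHalf := by
    intro z hz
    have hz' : 0 < z.im := hz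
    have hlim := (Complex.continuous_im.tendsto _).comp (hloc.tendsto_at hz)
    refine (mul_pos hw.height_pos hz').trans_le (ge_of_tendsto' hlim fun n => ?_)
    refine le_trans ?_ (hφ.im_le_im_iterate n (affineAt_mapsTo (hw.mem n) hz))
    rw [affineAt_im]
    exact mul_le_mul_of_nonneg_right (hw.height_le_im hφ n) hz'.le
  refine ⟨ψ, hdiff, hmaps, hψ, fun z hz => ?_⟩
  have hφc : ContinuousAt φ (ψ z) :=
    (hφ.differentiableOn.differentiableAt (isOpen_upperHalf.mem_nhds (hmaps hz))).continuousAt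
  have h1 : Tendsto (fun n => φ^[n + 1] (affineAt (w n) z)) atTop (𝓝 (φ (ψ z))) := by
    refine (hφc.tendsto.comp (hloc.tendsto_at hz)).congr fun n => ?_
    rw [Function.iterate_succ_apply']
    rfl
  have hz' : z - (translationLength a : ℂ) ∈ upperHalf := by simpa [upperHalf] using hz
  -- The truncated value at `n = 0` is immaterial: the index is shifted by one before use.
  have h2 : Tendsto (fun n => φ^[n] (affineAt (w (n - 1)) z)) atTop
      (𝓝 (ψ (z - (translationLength a : ℂ)))) := by
    refine hw.tendsto_iterate hdiff.continuousOn hψ hz' ?_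
    rw [← tendsto_add_atTop_iff_nat 1]
    have h3 := (Complex.continuous_ofReal.tendsto _).comp (hw.tendsto_re_sub hφ)
    have h4 := (((Complex.continuous_ofReal.tendsto ℓ).comp hw.tendsto_im).mul_const z).sub h3
    convert h4 using 2 with n
    · simp [affineAt]; ring
    · push_cast; ring
  exact tendsto_nhds_unique (h2.comp (tendsto_add_atTop_nat 1)) h1

end IsNonzeroHeightBISBS

/-! ### Intertwining of the two conjugations. -/

theorem theorem1p13 (φ : ℂ → ℂ) (hφ : IsParabolicSelfMap φ)
    (w w' : ℕ → ℂ) (a a' ℓ ℓ' : ℝ)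
    (hw : IsNonzeroHeightBISBS φ w a ℓ) (hw' : IsNonzeroHeightBISBS φ w' a' ℓ')
    (b₀ b₀' : ℝ) (hb₀ : b₀ = translationLength a) (hb₀' : b₀' = translationLength a') :
    a < 1 ∧ a' < 1 ∧ 0 < b₀ ∧ 0 < b₀' ∧
    (∃ ψ ψ' : ℂ → ℂ, IsConjugation φ w b₀ ψ ∧ IsConjugation φ w' b₀' ψ' ∧
      ∃ b₁ : ℝ,
        (∀ z ∈ upperHalf, ψ' (((b₀' / b₀ : ℝ) : ℂ) * z + (b₁ : ℂ)) = ψ z) ∧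
        (∀ n : ℕ, w' n =
          ψ (((b₀ / b₀' : ℝ) : ℂ) * (Complex.I - (b₁ : ℂ)) + (n : ℂ) * (b₀ : ℂ)))) ∧
    Tendsto (fun n => (w (n + 1)).re - (w n).re) atTop (𝓝 (ℓ * b₀)) ∧
    Tendsto (fun n => (w' (n + 1)).re - (w' n).re) atTop (𝓝 (ℓ' * b₀')) ∧
    ℓ * b₀ = ℓ' * b₀' := by
  subst hb₀ hb₀'
  obtain ⟨hs, c, hc⟩ := height_mul_eq_and_exists_tendsto hφ hw hw'
  have hb := hw.translationLength_pos hφ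
  have hb' := hw'.translationLength_pos hφ
  have hℓ' := hw'.height_pos
  refine ⟨hw.step_lt_one, hw'.step_lt_one, hb, hb', ?_, hw.tendsto_re_sub hφ,
    hw'.tendsto_re_sub hφ, hs⟩
  obtain ⟨ψ, hψ⟩ := hw.exists_isConjugation hφ
  obtain ⟨ψ', hψ'⟩ := hw'.exists_isConjugation hφ
  set b := translationLength a
  set b' := translationLength a'
  have hbc : (b : ℂ) ≠ 0 := by exact_mod_cast hb.ne'
  have hbc' : (b' : ℂ) ≠ 0 := by exact_mod_cast hb'.ne'
  have hℓc' : (ℓ' : ℂ) ≠ 0 := by exact_mod_cast hℓ'.ne'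
  have hsc : (ℓ : ℂ) * b = ℓ' * b' := by exact_mod_cast hs
  -- The shift is `b₁ = c / ℓ'`: `affineAt (w n) z - x' n` tends to `ℓ z + c`, which is `ℓ' ((b' /
  -- b) z + c / ℓ')` because `ℓ b = ℓ' b'`.
  have hrel : ∀ z ∈ upperHalf, ψ' (((b' / b : ℝ) : ℂ) * z + ((c / ℓ' : ℝ) : ℂ)) = ψ z := by
    intro z hz
    have hmem : ((b' / b : ℝ) : ℂ) * z + ((c / ℓ' : ℝ) : ℂ) ∈ upperHalf := by
      change 0 < Complex.im _
      rw [Complex.add_im, Complex.im_ofReal_mul, Complex.ofReal_im, add_zero]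
      exact mul_pos (div_pos hb' hb) hz
    refine tendsto_nhds_unique (hw'.tendsto_iterate hψ'.differentiableOn.continuousOn
      hψ'.tendsto_compact hmem (q := fun n => affineAt (w n) z) ?_)
      (((tendstoLocallyUniformlyOn_iff_forall_isCompact isOpen_upperHalf).2
        hψ.tendsto_compact).tendsto_at hz)
    have h1 := (((Complex.continuous_ofReal.tendsto ℓ).comp hw.tendsto_im).mul_const z).add
      ((Complex.continuous_ofReal.tendsto c).comp hc)
    convert h1 using 2 with n
    · simp [affineAt]; ring
    · push_cast
      field_simp
      linear_combination (-z) * hsc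
  refine ⟨ψ, ψ', hψ, hψ', c / ℓ', hrel, fun n => ?_⟩
  rw [← hrel]
  · have harg : ((b' / b : ℝ) : ℂ) * (((b / b' : ℝ) : ℂ) * (Complex.I - ((c / ℓ' : ℝ) : ℂ)) +
        (n : ℂ) * (b : ℂ)) + ((c / ℓ' : ℝ) : ℂ) = Complex.I + n * b' := by
      push_cast
      field_simp
      ring
    rw [harg]
    have hmem : Complex.I + n * (b' : ℂ) ∈ upperHalf := by simp [upperHalf]
    -- `φ^[k] (w' (k + n))` is constantly `w' n`, while `w' (k + n) - x' k` tends to `ℓ' (i + n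
    -- b')`; hence `w' n = ψ' (i + n b')`.
    refine tendsto_nhds_unique (tendsto_const_nhds.congr fun k => (hw'.iterate_map n k).symm)
      (hw'.tendsto_iterate hψ'.differentiableOn.continuousOn hψ'.tendsto_compact hmem
        (q := fun k => w' (k + n)) ?_)
    have h1 := ((Complex.continuous_ofReal.tendsto _).comp (hw'.tendsto_re_add_sub hφ n)).add
      (((Complex.continuous_ofReal.tendsto ℓ').comp
        (hw'.tendsto_im.comp (tendsto_add_atTop_nat n))).mul_const Complex.I)
    convert h1 using 2 with k
    · conv_lhs => rw [← Complex.re_add_im (w' (k + n))]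
      simp only [Function.comp_apply]
      push_cast
      ring
    · push_cast
      ring
  · change 0 < Complex.im _
    have : 0 < b / b' := div_pos hb hb'
    rw [Complex.add_im, Complex.im_ofReal_mul]
    simpa using this
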